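/- Let $X \neq \{0\}$ be a real Lindenstrauss space, that is, a real Banach space whose dual $X^*$ is isometrically isomorphic to $L_1(\mu)$ for some measure $\mu$. Let $B_{X^*}$ be the closed unit ball of $X^*$ and $S_X$ the unit sphere of $X$. Let $F$ be a $w^*$-closed proper face of $B_{X^*}$: a convex set $F \subsetneq B_{X^*}$, closed in $\sigma(X^*,X)$, such that whenever $f, g \in B_{X^*}$ and $t f + (1-t) g \in F$ for some $0 < t < 1$, then $f, g \in F$. Then there exists $x \in S_X$ such that $F \subseteq D(x)$, where $D(x) = \{x^* \in X^* : \|x^*\| = 1,\ x^*(x) = 1\}$. -/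

import Mathlib

universe u v

/-- A real normed space `X` is a Lindenstrauss space if its dual is isometrically isomorphic (as a
normed space) to `L₁(μ)` for some measure `μ`. Completeness of `X` is a separate type-class
assumption. The measure space may live in any universe. -/
def IsLindenstrauss (X : Type u) [NormedAddCommGroup X] [NormedSpace ℝ X] : Prop :=
  ∃ (Ω : Type v) (_ : MeasurableSpace Ω) (μ : MeasureTheory.Measure Ω),
    Nonempty (StrongDual ℝ X ≃ₗᵢ[ℝ] MeasureTheory.Lp ℝ 1 μ)

/-- A face of a set `C` in a real vector space: a convex extreme subset of `C`. -/
def IsFace {E : Type u} [AddCommGroup E] [Module ℝ E] (C F : Set E) : Prop :=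
  Convex ℝ F ∧ IsExtreme ℝ C F

/-- A proper face of `C`: a face of `C` different from `C`. -/
def IsProperFace {E : Type u} [AddCommGroup E] [Module ℝ E] (C F : Set E) : Prop :=
  IsFace C F ∧ F ≠ C

/-- A set of functionals is w*-closed if it is closed in the topology `σ(X*, X)`. -/
def IsWeakStarClosed {X : Type u} [NormedAddCommGroup X] [NormedSpace ℝ X]
    (F : Set (StrongDual ℝ X)) : Prop :=
  IsClosed ((WeakDual.toStrongDual : WeakDual ℝ X → StrongDual ℝ X) ⁻¹' F)

/-- `D(x)`: the norm-one functionals that attain the value `1` at `x`. -/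
def dualFace {X : Type u} [NormedAddCommGroup X] [NormedSpace ℝ X] (x : X) :
    Set (StrongDual ℝ X) :=
  {f | ‖f‖ = 1 ∧ f x = 1}

open MeasureTheory Metric Filter Topology Set

/-! Medians in $L_1$ pass to $X^*$ and make one correction step possible: if $\|x\|<1$ and $f(x)\ge
1-\varepsilon$ on $F$, then for every $c<1$ some $y$ in the unit ball within $\varepsilon$ of $x$
has $f(y)\ge c$ on $F$. By w*-compactness and Sion's minimax theorem, $y$ may depend on $f$; by
Hahn–Banach it then suffices that $\|f-g\|+g(x)+\varepsilon\|g\|\ge 1$ for all $g$. The median $u$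
of $0,f,g$ gives this, since $u/\|u\|\in F$ (if $u\ne0$) forces $u(x)\ge(1-\varepsilon)\|u\|$. Steps
with $\varepsilon=2^{-n}$ converge to the desired vector. -/

/-- Distances in `ℝ` between `0`, `a`, `b` add up through their median. -/
theorem abs_median_identities (a b : ℝ) :
    let u := (a ⊓ 0) ⊔ ((a ⊔ 0) ⊓ b)
    |a| = |u| + |a - u| ∧ |b| = |u| + |b - u| ∧ |a - b| = |a - u| + |b - u| := by
  intro u
  rcases le_total a 0 with ha | ha <;> rcases le_total a b with hab | hab <;>
    rcases le_total b 0 with hb | hb <;>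
    simp only [u, inf_eq_left.2, inf_eq_right.2, sup_eq_left.2, sup_eq_right.2, ha, hb, hab] <;>
    refine ⟨?_, ?_, ?_⟩ <;>
    grind

/-- Real `L¹` spaces are median spaces: any `f` and `g` have a median `u` with `0`. -/
theorem MeasureTheory.Lp.exists_median {Ω : Type*} [MeasurableSpace Ω] {μ : Measure Ω}
    (f g : Lp ℝ 1 μ) :
    ∃ u : Lp ℝ 1 μ, ‖f‖ = ‖u‖ + ‖f - u‖ ∧ ‖g‖ = ‖u‖ + ‖g - u‖ ∧
      ‖f - g‖ = ‖f - u‖ + ‖g - u‖ := by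
  set u : Lp ℝ 1 μ := (f ⊓ 0) ⊔ ((f ⊔ 0) ⊓ g) with hu_def
  have hu : ∀ᵐ ω ∂μ, u ω = (f ω ⊓ 0) ⊔ ((f ω ⊔ 0) ⊓ g ω) := by
    filter_upwards [Lp.coeFn_sup (f ⊓ 0) ((f ⊔ 0) ⊓ g), Lp.coeFn_inf f 0,
      Lp.coeFn_inf (f ⊔ 0) g, Lp.coeFn_sup f 0, Lp.coeFn_zero ℝ 1 μ] with ω h₁ h₂ h₃ h₄ h₅
    rw [hu_def, h₁]
    simp only [Pi.sup_apply, Pi.inf_apply, h₂, h₃, h₄, h₅, Pi.zero_apply]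
  have norm_add : ∀ p q r : Lp ℝ 1 μ, (∀ᵐ ω ∂μ, |p ω| = |q ω| + |r ω|) → ‖p‖ = ‖q‖ + ‖r‖ := by
    intro p q r h
    simp only [L1.norm_eq_integral_norm, Real.norm_eq_abs]
    rw [← integral_add (L1.integrable_coeFn q).abs (L1.integrable_coeFn r).abs]
    exact integral_congr_ae h
  refine ⟨u, norm_add _ _ _ ?_, norm_add _ _ _ ?_, norm_add _ _ _ ?_⟩
  · filter_upwards [hu, Lp.coeFn_sub f u] with ω h₁ h₂
    rw [h₂, Pi.sub_apply, h₁]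
    exact (abs_median_identities (f ω) (g ω)).1
  · filter_upwards [hu, Lp.coeFn_sub g u] with ω h₁ h₂
    rw [h₂, Pi.sub_apply, h₁]
    exact (abs_median_identities (f ω) (g ω)).2.1
  · filter_upwards [hu, Lp.coeFn_sub f g, Lp.coeFn_sub f u, Lp.coeFn_sub g u] with ω h₁ h₂ h₃ h₄
    rw [h₂, h₃, h₄, Pi.sub_apply, Pi.sub_apply, Pi.sub_apply, h₁]
    exact (abs_median_identities (f ω) (g ω)).2.2

/-- The dual of a Lindenstrauss space is a median space. -/
theorem IsLindenstrauss.exists_median {X : Type u} [NormedAddCommGroup X] [NormedSpace ℝ X]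
    (hX : IsLindenstrauss.{u, v} X) (f g : StrongDual ℝ X) :
    ∃ u : StrongDual ℝ X, ‖f‖ = ‖u‖ + ‖f - u‖ ∧ ‖g‖ = ‖u‖ + ‖g - u‖ ∧
      ‖f - g‖ = ‖f - u‖ + ‖g - u‖ := by
  obtain ⟨Ω, _, μ, ⟨e⟩⟩ := hX
  obtain ⟨u, h₁, h₂, h₃⟩ := Lp.exists_median (e f) (e g)
  refine ⟨e.symm u, ?_⟩
  simpa only [← e.norm_map, map_sub, e.apply_symm_apply] using ⟨h₁, h₂, h₃⟩

/-- Elements of a proper face of the unit ball have norm one. -/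
theorem IsProperFace.norm_eq_one {E : Type u} [NormedAddCommGroup E] [NormedSpace ℝ E] {F : Set E}
    (hF : IsProperFace (closedBall (0 : E) 1) F) {f : E} (hf : f ∈ F) : ‖f‖ = 1 := by
  have hsub := hF.1.2.subset
  have h0 : (0 : E) ∉ F := by
    intro h0
    refine hF.2 (hsub.antisymm fun g hg => ?_)
    refine hF.1.2.left_mem_of_mem_openSegment hg (y := -g) (by simpa using hg) h0 ?_
    exact ⟨1 / 2, 1 / 2, by norm_num, by norm_num, by norm_num, by simp⟩
  have hle : ‖f‖ ≤ 1 := by simpa using hsub hf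
  refine hle.antisymm (not_lt.1 fun hlt => h0 ?_)
  have hf0 : f ≠ 0 := fun h => h0 (h ▸ hf)
  have hpos : 0 < ‖f‖ := norm_pos_iff.2 hf0
  refine hF.1.2.left_mem_of_mem_openSegment (x := 0) (by simp) (y := ‖f‖⁻¹ • f) ?_ hf ?_
  · simp [norm_smul, hpos.ne']
  · exact ⟨1 - ‖f‖, ‖f‖, by linarith, hpos, by ring, by simp [smul_smul, hpos.ne']⟩

/-- If `f` in a face of the unit ball splits norm-additively as `u + (f - u)`, then the normalization
of `u` belongs to the face. -/
theorem IsProperFace.inv_norm_smul_mem {E : Type u} [NormedAddCommGroup E] [NormedSpace ℝ E]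
    {F : Set E} (hF : IsProperFace (closedBall (0 : E) 1) F) {f u : E} (hf : f ∈ F)
    (hu : ‖f‖ = ‖u‖ + ‖f - u‖) (hu0 : u ≠ 0) : ‖u‖⁻¹ • u ∈ F := by
  rw [hF.norm_eq_one hf] at hu
  have hpos : 0 < ‖u‖ := norm_pos_iff.2 hu0
  rcases eq_or_ne f u with rfl | hne
  · have : ‖f‖ = 1 := hF.norm_eq_one hf
    simpa [this] using hf
  have hpos' : 0 < ‖f - u‖ := norm_pos_iff.2 (sub_ne_zero.2 hne)
  refine hF.1.2.left_mem_of_mem_openSegment (y := ‖f - u‖⁻¹ • (f - u)) ?_ ?_ hf ?_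
  · simp [norm_smul, hpos.ne']
  · simp [norm_smul, hpos'.ne']
  · exact ⟨‖u‖, ‖f - u‖, hpos, hpos', hu.symm, by simp [smul_smul, hpos.ne', hpos'.ne']⟩

theorem ContinuousLinearMap.norm_le_of_forall_mem_ball {X : Type*} [NormedAddCommGroup X]
    [NormedSpace ℝ X] (φ : StrongDual ℝ X) {M : ℝ} (h : ∀ y ∈ ball (0 : X) 1, φ y ≤ M) :
    ‖φ‖ ≤ M := by
  rw [← φ.sSup_unit_ball_eq_norm]
  refine csSup_le ((nonempty_ball.2 one_pos).image _) ?_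
  rintro _ ⟨y, hy, rfl⟩
  have h' := h (-y) (by simpa using hy)
  rw [map_neg] at h'
  exact abs_le.2 ⟨by linarith, h y hy⟩

/-- The support function of the intersection of two open balls is bounded below by the infimal
convolution of their support functions. -/
theorem exists_mem_ball_inter_ball_lt {X : Type*} [NormedAddCommGroup X] [NormedSpace ℝ X] {x : X}
    {δ c : ℝ} (hδ : 0 < δ) (hne : (ball (0 : X) 1 ∩ ball x δ).Nonempty) (f : StrongDual ℝ X)
    (h : ∀ g : StrongDual ℝ X, c < ‖f - g‖ + g x + δ * ‖g‖) :
    ∃ y ∈ ball (0 : X) 1 ∩ ball x δ, c < f y := by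
  by_contra! hcon
  -- `S` is the strict hypograph of `f - c` over the unit ball; it misses `ball x δ ×ˢ Ici 0`
  -- exactly because `f ≤ c` on the intersection of the balls.
  set S : Set (X × ℝ) := {p | p.1 ∈ ball (0 : X) 1} ∩ {p | p.2 - f p.1 < -c} with hS
  have hSopen : IsOpen S :=
    (isOpen_ball.preimage continuous_fst).inter (isOpen_lt (by fun_prop) continuous_const)
  have hSconv : Convex ℝ S :=
    ((convex_ball (0 : X) 1).linear_preimage (LinearMap.fst ℝ X ℝ)).inter
      (convex_halfSpace_lt
        (LinearMap.snd ℝ X ℝ - f.toLinearMap ∘ₗ LinearMap.fst ℝ X ℝ).isLinear (-c))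
  have hdisj : Disjoint S (ball x δ ×ˢ Ici (0 : ℝ)) := by
    refine Set.disjoint_left.2 ?_
    rintro ⟨y, t⟩ ⟨hy, ht⟩ ⟨hy', ht'⟩
    have := hcon y ⟨hy, hy'⟩
    simp only [mem_ofPred_eq, mem_Ici] at ht ht'
    linarith
  obtain ⟨φ, r, hφS, hφT⟩ := geometric_hahn_banach_open hSconv hSopen
    ((convex_ball x δ).prod (convex_Ici (0 : ℝ))) hdisj
  set ψ : StrongDual ℝ X := φ.comp (ContinuousLinearMap.inl ℝ X ℝ) with hψ
  set s : ℝ := φ (0, 1) with hs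
  have hφ : ∀ y t, φ (y, t) = ψ y + t * s := by
    intro y t
    have : (y, t) = (y, (0 : ℝ)) + t • ((0 : X), (1 : ℝ)) := by simp
    rw [this, map_add, map_smul]
    simp [hψ, hs]
  have key : ∀ y ∈ ball (0 : X) 1, ∀ z ∈ ball x δ, ∀ t < f y - c, ψ y + t * s < ψ z := by
    intro y hy z hz t ht
    have h₁ := hφS (y, t) ⟨hy, by simp only [mem_ofPred_eq]; linarith⟩
    have h₂ := hφT (z, 0) ⟨hz, by simp⟩
    rw [hφ] at h₁ h₂
    linarith
  -- The separating hyperplane is not vertical because the two balls share a point.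
  have hspos : 0 < s := by
    obtain ⟨w, hw⟩ := hne
    have h₁ := key w hw.1 w hw.2 (f w - c - 1) (by linarith)
    have h₂ := hcon w hw
    by_contra! hs0
    nlinarith
  set g : StrongDual ℝ X := -(s⁻¹ • ψ) with hg
  have hψg : ∀ y, ψ y = -(s * g y) := by
    intro y
    simp [hg, hspos.ne']
  have key' : ∀ y ∈ ball (0 : X) 1, ∀ z ∈ ball x δ, f y - g y ≤ c - g z := by
    intro y hy z hz
    have : f y - c ≤ g y - g z := by
      refine le_of_forall_lt fun t ht => ?_
      have := key y hy z hz t ht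
      rw [hψg, hψg] at this
      refine lt_of_mul_lt_mul_left (a := s) ?_ hspos.le
      linarith
    linarith
  -- Suprema over `y`, then over `z = x + δ • y`, give `‖f - g‖ + g x + δ * ‖g‖ ≤ c`, against `h`.
  have h₁ : ∀ z ∈ ball x δ, ‖f - g‖ ≤ c - g z := fun z hz =>
    (f - g).norm_le_of_forall_mem_ball fun y hy => by simpa using key' y hy z hz
  have h₂ : ‖δ • g‖ ≤ c - ‖f - g‖ - g x := by
    refine (δ • g).norm_le_of_forall_mem_ball fun y hy => ?_
    have := h₁ (x + δ • y) (by
      rw [mem_ball_zero_iff] at hy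
      simpa [norm_smul, abs_of_pos hδ] using mul_lt_of_lt_one_right hδ hy)
    rw [map_add, map_smul, smul_eq_mul] at this
    rw [smul_apply, smul_eq_mul]
    linarith
  rw [norm_smul, Real.norm_eq_abs, abs_of_pos hδ] at h₂
  linarith [h g]

/-- Minimax for a weak-star compact convex set of functionals and a convex set of vectors. -/
theorem exists_forall_lt_apply_of_isCompact {X : Type*} [NormedAddCommGroup X] [NormedSpace ℝ X]
    {K : Set (WeakDual ℝ X)} (hK : IsCompact K) (hKconv : Convex ℝ K) (hKne : K.Nonempty)
    {A : Set X} (hA : Convex ℝ A) {c : ℝ} (h : ∀ f ∈ K, ∃ y ∈ A, c < f y) :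
    ∃ y ∈ A, ∀ f ∈ K, c < f y := by
  obtain ⟨s, hsA, hsfin, hs⟩ := hK.elim_finite_subcover_image (b := A)
    (c := fun y => {f : WeakDual ℝ X | c < f y})
    (fun y _ => isOpen_lt continuous_const (WeakDual.eval_continuous y))
    (fun f hf => by simpa using h f hf)
  refine Sion.exists_lt_iInf_of_lt_iInf_of_finite (f := fun (f : WeakDual ℝ X) (y : X) => f y)
    hKne hK ?_ ?_ hA ?_ ?_ hKconv hsfin hsA fun f hf => by simpa using hs hf
  · exact fun y _ => (WeakDual.eval_continuous y).lowerSemicontinuous.lowerSemicontinuousOn _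
  · exact fun y _ => (LinearMap.convexOn
      ((ContinuousLinearMap.apply ℝ ℝ y).toLinearMap ∘ₗ WeakDual.toStrongDual.toLinearMap)
      hKconv).quasiconvexOn
  · exact fun f _ => (map_continuous f).upperSemicontinuous.upperSemicontinuousOn _
  · exact fun f _ => (LinearMap.concaveOn (WeakDual.toStrongDual f).toLinearMap hA).quasiconcaveOn

/-- One correction step: a vector of the unit ball on which all functionals of the face are almost
one can be moved a little to make them larger. -/
theorem IsLindenstrauss.exists_correction {X : Type u} [NormedAddCommGroup X] [NormedSpace ℝ X]
    (hX : IsLindenstrauss.{u, v} X) {F : Set (StrongDual ℝ X)}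
    (hF : IsProperFace (closedBall (0 : StrongDual ℝ X) 1) F) (hFc : IsWeakStarClosed F)
    (hne : F.Nonempty) {ε c : ℝ} (hε : 0 < ε) (hc : c < 1) {x : X} (hx : x ∈ ball (0 : X) 1)
    (hxF : ∀ f ∈ F, 1 - ε ≤ f x) :
    ∃ y ∈ ball (0 : X) 1, dist y x ≤ ε ∧ ∀ f ∈ F, c ≤ f y := by
  have hFcomp : IsCompact ((WeakDual.toStrongDual : WeakDual ℝ X → StrongDual ℝ X) ⁻¹' F) :=
    WeakDual.isCompact_of_bounded_of_closed
      (WeakDual.isBounded_toStrongDual_preimage_iff_isBounded.2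
        (isBounded_closedBall.subset hF.1.2.subset)) hFc
  have hFconv : Convex ℝ ((WeakDual.toStrongDual : WeakDual ℝ X → StrongDual ℝ X) ⁻¹' F) :=
    hF.1.1.linear_preimage WeakDual.toStrongDual.toLinearMap
  obtain ⟨y, hy, hyF⟩ := exists_forall_lt_apply_of_isCompact hFcomp hFconv
    (hne.preimage WeakDual.toStrongDual.surjective)
    ((convex_ball (0 : X) 1).inter (convex_ball x ε)) (c := c) fun f hf => by
      refine exists_mem_ball_inter_ball_lt hε ⟨x, hx, mem_ball_self hε⟩ (WeakDual.toStrongDual f)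
        fun g => hc.trans_le ?_
      set f' := WeakDual.toStrongDual f
      have hf1 : ‖f'‖ = 1 := hF.norm_eq_one hf
      obtain ⟨u, h₁, h₂, h₃⟩ := hX.exists_median f' g
      have hux : (1 - ε) * ‖u‖ ≤ u x := by
        rcases eq_or_ne u 0 with rfl | hu0
        · simp
        have hpos : 0 < ‖u‖ := norm_pos_iff.2 hu0
        have := hxF _ (hF.inv_norm_smul_mem hf h₁ hu0)
        rwa [smul_apply, smul_eq_mul, inv_mul_eq_div, le_div_iff₀ hpos] at this
      have hgu : -‖g - u‖ ≤ g x - u x := by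
        have h := (g - u).le_of_opNorm_le_of_le le_rfl (mem_ball_zero_iff.1 hx).le
        rw [mul_one, Real.norm_eq_abs] at h
        simpa using (abs_le.1 h).1
      have := mul_nonneg hε.le (norm_nonneg (g - u))
      -- The terms `‖g - u‖` cancel, leaving at least `‖f' - u‖ + ‖u‖ = 1`.
      rw [h₃, h₂]
      linarith
  exact ⟨y, hy.1, hy.2.le, fun f hf => (hyF (StrongDual.toWeakDual f) hf).le⟩

/-- A nonempty weak-star closed proper face of the dual unit ball of a Lindenstrauss space is
exposed by a vector of norm at most one. -/
theorem IsLindenstrauss.exists_norm_le_one_forall_one_le {X : Type u} [NormedAddCommGroup X]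
    [NormedSpace ℝ X] [CompleteSpace X] (hX : IsLindenstrauss.{u, v} X) {F : Set (StrongDual ℝ X)}
    (hF : IsProperFace (closedBall (0 : StrongDual ℝ X) 1) F) (hFc : IsWeakStarClosed F)
    (hne : F.Nonempty) : ∃ x : X, ‖x‖ ≤ 1 ∧ ∀ f ∈ F, 1 ≤ f x := by
  have step : ∀ (n : ℕ) (x : {x : X // x ∈ ball (0 : X) 1 ∧ ∀ f ∈ F, 1 - (1 / 2) ^ n ≤ f x}),
      ∃ y : {x : X // x ∈ ball (0 : X) 1 ∧ ∀ f ∈ F, 1 - (1 / 2) ^ (n + 1) ≤ f x},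
        dist y.1 x.1 ≤ (1 / 2) ^ n := by
    rintro n ⟨x, hx, hxF⟩
    obtain ⟨y, hy, hyx, hyF⟩ := hX.exists_correction hF hFc hne (ε := (1 / 2) ^ n)
      (c := 1 - (1 / 2) ^ (n + 1)) (by positivity) (sub_lt_self _ (by positivity)) hx hxF
    exact ⟨⟨y, hy, hyF⟩, hyx⟩
  choose next hnext using step
  -- The start `0` is admissible because `1 - (1 / 2) ^ 0 = 0`.
  let z (n : ℕ) : {x : X // x ∈ ball (0 : X) 1 ∧ ∀ f ∈ F, 1 - (1 / 2) ^ n ≤ f x} :=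
    Nat.rec ⟨0, by simp⟩ next n
  have hz : ∀ n, dist (z n).1 (z (n + 1)).1 ≤ 1 * (1 / 2) ^ n := fun n => by
    rw [one_mul, dist_comm]
    exact hnext n (z n)
  obtain ⟨x, hx⟩ := cauchySeq_tendsto_of_complete
    (cauchySeq_of_le_geometric (1 / 2) 1 one_half_lt_one hz)
  refine ⟨x, le_of_tendsto hx.norm (.of_forall fun n => (mem_ball_zero_iff.1 (z n).2.1).le),
    fun f hf => ?_⟩
  have hlim : Tendsto (fun n : ℕ => (1 : ℝ) - (1 / 2) ^ n) atTop (𝓝 (1 - 0)) :=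
    (tendsto_pow_atTop_nhds_zero_of_lt_one (by norm_num) one_half_lt_one).const_sub 1
  rw [sub_zero] at hlim
  exact le_of_tendsto_of_tendsto' hlim ((f.continuous.tendsto x).comp hx) fun n => (z n).2.2 f hf

theorem mainTheorem4 (X : Type u) [NormedAddCommGroup X] [NormedSpace ℝ X] [CompleteSpace X]
    [Nontrivial X] (hX : IsLindenstrauss.{u, v} X)
    (F : Set (StrongDual ℝ X)) (hF : IsProperFace (Metric.closedBall (0 : StrongDual ℝ X) 1) F)
    (hFc : IsWeakStarClosed F) :
    ∃ x ∈ Metric.sphere (0 : X) 1, F ⊆ dualFace x := by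
  rcases F.eq_empty_or_nonempty with rfl | hne
  · obtain ⟨x, hx⟩ := NormedSpace.sphere_nonempty (x := (0 : X)) (r := 1) |>.2 zero_le_one
    exact ⟨x, hx, empty_subset _⟩
  obtain ⟨x, hx, hxF⟩ := hX.exists_norm_le_one_forall_one_le hF hFc hne
  have hle : ∀ f ∈ F, f x ≤ ‖x‖ := fun f hf => by
    have h := f.le_opNorm x
    rw [hF.norm_eq_one hf, one_mul] at h
    exact (le_abs_self _).trans h
  obtain ⟨f₀, hf₀⟩ := hne
  refine ⟨x, ?_, fun f hf => ⟨hF.norm_eq_one hf, ((hle f hf).trans hx).antisymm (hxF f hf)⟩⟩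
  rw [mem_sphere_zero_iff_norm]
  exact hx.antisymm ((hxF f₀ hf₀).trans (hle f₀ hf₀))
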